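/- **Corollary (tree entropy $z_{NF}$).** For $N\ge 1$ and positive integers $g_1,\dots,g_d$ let $C_N^{g_1,\dots,g_d}$ be the circulant graph with vertex set $\mathbb{Z}/N\mathbb{Z}$ that has, for each vertex $v$ and each $i\in\{1,\dots,d\}$, one edge joining $v$ to $v+g_i$ (multiple edges and loops are kept, so that the graph is $2d$-regular when loops are counted twice). Let $\tau(G)$ be the number of spanning trees of a finite graph $G$ (connected subgraphs without cycles that contain all vertices; parallel edges are distinguished), and let $\Delta_G f(x)=\sum_{y\sim x}(f(x)-f(y))$, with neighbours counted with edge multiplicity, be its combinatorial Laplacian. Let $d\ge 1$ and $\beta\ge1$ be integers and let $1\le\gamma_1\le\dots\le\gamma_{d-1}\le\lfloor\beta/2\rfloor$ be integers (for $d=1$ there are no $\gamma$'s). Put $$\mu_k=2(d-1)-2\sum_{m=1}^{d-1}\cos(2\pi k\gamma_m/\beta),\qquad k=0,1,\dots,\beta-1.$$ These numbers are the eigenvalues, with multiplicity, of the Laplacian on $C_\beta^{\gamma_1,\dots,\gamma_{d-1}}$; that is, its characteristic polynomial is $\prod_{k=0}^{\beta-1}(X-\mu_k)$. The tree entropy $$z_{NF}(\beta;\gamma_1,\dots,\gamma_{d-1})=\lim_{n\to\infty}\frac{\log\tau\bigl(C_{\beta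 n}^{1,\gamma_1n,\dots,\gamma_{d-1}n}\bigr)}{\beta n}$$ exists and is given by $$z_{NF}(\beta;\gamma_1,\dots,\gamma_{d-1})=\frac1\beta\sum_{k=1}^{\beta-1}\operatorname{arccosh}\Bigl(d-\sum_{m=1}^{d-1}\cos(2\pi k\gamma_m/\beta)\Bigr)=\int_0^\infty\Bigl(e^{-t}-\frac1\beta\sum_{k=0}^{\beta-1}e^{-\mu_kt}e^{-2t}I_0(2t)\Bigr)\frac{dt}{t},$$ where the integral converges absolutely and $I_0(x)=\sum_{j\ge0}\frac{(x/2)^{2j}}{(j!)^2}$ is the modified Bessel function of the first kind of order zero. -/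

import Mathlib

open scoped Graph

noncomputable section

namespace CirculantEntropy

/-- A (multi)graph is connected if it has a vertex and any two of its vertices are joined by a
finite sequence of successively adjacent vertices. -/
def IsConnected {V E : Type*} (G : Graph V E) : Prop :=
  V(G).Nonempty ∧ ∀ x ∈ V(G), ∀ y ∈ V(G), Relation.ReflTransGen G.Adj x y

/-- The (multi)graph `G` contains a cycle: distinct vertices `x 0, …, x k` and distinct edges
`e 0, …, e k` such that `e i` joins `x i` to `x (i + 1)`, indices taken modulo `k + 1`. A loop is a
cycle (`k = 0`), and so is a pair of parallel edges (`k = 1`). -/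
def HasCycle {V E : Type*} (G : Graph V E) : Prop :=
  ∃ (k : ℕ) (x : Fin (k + 1) → V) (e : Fin (k + 1) → E),
    Function.Injective x ∧ Function.Injective e ∧ ∀ i, G.IsLink (e i) (x i) (x (i + 1))

/-- `T` is a spanning tree of `G`: a connected subgraph of `G` without cycles that has the same
vertex set as `G`. -/
def IsSpanningTree {V E : Type*} (T G : Graph V E) : Prop :=
  T ≤ G ∧ V(T) = V(G) ∧ IsConnected T ∧ ¬ HasCycle T

/-- The number `τ(G)` of spanning trees of a finite (multi)graph `G`. -/
def numSpanningTrees {V E : Type*} (G : Graph V E) : ℕ :=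
  {T : Graph V E | IsSpanningTree T G}.ncard

/-- The circulant graph `C_N^{γ_1, …, γ_d}`: the vertex set is `ℤ/Nℤ`, and for every vertex `v` and
every index `i` there is one edge, labelled `(v, i)`, that joins `v` to `v + γ_i`. With multiple
edges (and loops, counted twice) it is `2d`-regular. -/
def circulant (N : ℕ) {d : ℕ} (γ : Fin d → ℕ) : Graph (ZMod N) (ZMod N × Fin d) where
  vertexSet := Set.univ
  IsLink e x y := (x = e.1 ∧ y = e.1 + (γ e.2 : ZMod N)) ∨ (x = e.1 + (γ e.2 : ZMod N) ∧ y = e.1)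
  isLink_symm := by
    intro e _
    exact ⟨fun x y h => h.elim (fun h => Or.inr ⟨h.2, h.1⟩) (fun h => Or.inl ⟨h.2, h.1⟩)⟩
  eq_or_eq_of_isLink_of_isLink := by
    rintro e x y v w (⟨h1, h2⟩ | ⟨h1, h2⟩) (⟨h3, h4⟩ | ⟨h3, h4⟩)
    · exact Or.inl (h1.trans h3.symm)
    · exact Or.inr (h1.trans h4.symm)
    · exact Or.inr (h1.trans h4.symm)
    · exact Or.inl (h1.trans h3.symm)
  left_mem_of_isLink := fun _ _ _ _ => Set.mem_univ _

/-- The combinatorial Laplacian `(Δ_G f)(x) = ∑_{y ∼ x} (f x - f y)` of a finite (multi)graph all of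
whose vertex type is its vertex set; a neighbour `y` is counted once for each edge that joins it
to `x`. -/
def laplacian {V E : Type*} [Fintype V] (G : Graph V E) : (V → ℝ) →ₗ[ℝ] (V → ℝ) where
  toFun f x := ∑ y, ({e | G.IsLink e x y}.ncard : ℝ) * (f x - f y)
  map_add' f g := by
    funext x
    simp only [Pi.add_apply, ← Finset.sum_add_distrib]
    exact Finset.sum_congr rfl fun y _ => by ring
  map_smul' c f := by
    funext x
    simp only [Pi.smul_apply, smul_eq_mul, RingHom.id_apply, Finset.mul_sum]
    exact Finset.sum_congr rfl fun y _ => by ring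

/-- The tree entropy of the sequence of finite graphs `G n` exists and equals `z`:
`log τ(G n) / |V(G n)| → z` as `n → ∞`. -/
def HasTreeEntropy {V E : ℕ → Type*} (G : ∀ n, Graph (V n) (E n)) (z : ℝ) : Prop :=
  Filter.Tendsto (fun n => Real.log (numSpanningTrees (G n)) / (V(G n).ncard : ℝ))
    Filter.atTop (nhds z)

/-- The modified Bessel function of the first kind of order zero,
`I_0(x) = ∑_{j ≥ 0} (x / 2)^{2 j} / (j!)^2`. -/
def besselI0 (x : ℝ) : ℝ := ∑' j : ℕ, (x / 2) ^ (2 * j) / (j.factorial : ℝ) ^ 2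

/-- The graph `C_{β n}^{1, γ_1 n, …, γ_{d-1} n}`. -/
def nonFixedCirculant (β : ℕ) {r : ℕ} (γ : Fin r → ℕ) (n : ℕ) :
    Graph (ZMod (β * n)) (ZMod (β * n) × Fin (r + 1)) :=
  circulant (β * n) (Fin.cons 1 fun m => γ m * n)

/-- `μ_k = 2 (d - 1) - 2 ∑_{m=1}^{d-1} cos (2 π k γ_m / β)`. -/
def mu (d β : ℕ) (γ : Fin (d - 1) → ℕ) (k : ℕ) : ℝ :=
  2 * ((d : ℝ) - 1) - 2 * ∑ m, Real.cos (2 * Real.pi * k * γ m / β)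

end CirculantEntropy

end

/-!
The entropy, the integral and the spectrum are all expressed by the eigenvalues of circulant
Laplacians.

*Spanning trees.* The Laplacian with the row of a vertex `r` replaced by `δ_r` is expanded
multilinearly over the choice of one incident edge at each other vertex. A choice contributes `1` if
following the chosen edges always leads to `r`, and `0` otherwise. Hence this determinant counts the
arborescences rooted at `r`, which are the spanning trees oriented towards `r`
(`numSpanningTrees_eq_ncard`, `det_updateRow_laplacian`). Summing over `r` gives the matrix-tree
theorem for multigraphs in the form `charpoly_laplacian_coeff_one`.

*Spectrum.* The discrete Fourier transform diagonalizes the Laplacian of a circulant graph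
(`charpoly_laplacian_circulant`).

*Entropy.* In `C_{β n}^{1, γ_1 n, …}` the contribution of the long edges to the eigenvalue with
index `k + β l` depends only on `k`. With `cosh θ_k = 1 + μ_k / 2`, the product over `l` is
`2 cosh (n θ_k) - 2 cos (2 π k / β)` for `k ≠ 0`, and `n ^ 2` for `k = 0` without the zero
eigenvalue. This gives a closed form for the number of spanning trees
(`numSpanningTrees_nonFixed`), and each factor with `k ≠ 0` grows like `e^{n θ_k}`
(`hasTreeEntropy_nonFixed`).

*Integral.* Since `I_0(2t)` is the average of `e^{2t cos x}` over a period, Fubini's theorem and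
Frullani's integral turn `∫ (e^{-t} - e^{-2t cosh θ} I_0(2t)) dt / t` into the average of
`log (2 cosh θ - 2 cos x)`, which is `θ` by Jensen's formula (`integral_bessel`). Averaging over
`k` with `θ = θ_k` gives the integral formula.
-/

namespace CirculantEntropy

/-! ### Arborescences -/

section Arborescence

variable {V E : Type*}

/-- A choice function `φ` assigns to each vertex either nothing or an edge together with the other
end of that edge. Following it once leads to the parent; a vertex without a choice is its own
parent. -/
def parent (φ : V → Option (E × V)) (v : V) : V := ((φ v).map Prod.snd).getD v

/-- The set of edges that a choice function selects. -/
def chosenEdges (φ : V → Option (E × V)) : Set E := {e | ∃ v y, φ v = some (e, y)}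

/-- A choice function is an arborescence of `G` rooted at `r` if each vertex other than `r` selects
an incident edge of `G`, the root selects none, and following parents leads from each vertex to
`r`. -/
structure IsArborescence (G : Graph V E) (r : V) (φ : V → Option (E × V)) : Prop where
  root : φ r = none
  link : ∀ v, v ≠ r → ∃ e y, φ v = some (e, y) ∧ G.IsLink e v y
  reach : ∀ v, ∃ n, (parent φ)^[n] v = r

variable {G T : Graph V E} {r v w y z : V} {e : E} {φ ψ : V → Option (E × V)}

lemma parent_of_eq_some (h : φ v = some (e, y)) : parent φ v = y := by simp [parent, h]

lemma parent_of_eq_none (h : φ v = none) : parent φ v = v := by simp [parent, h]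

lemma IsArborescence.isLink (h : IsArborescence G r φ) (hv : φ v = some (e, y)) :
    G.IsLink e v y := by
  have hvr : v ≠ r := by
    rintro rfl
    simp [h.root] at hv
  obtain ⟨e', y', h1, h2⟩ := h.link v hvr
  rw [hv] at h1
  simp only [Option.some.injEq, Prod.mk.injEq] at h1
  rw [h1.1, h1.2]
  exact h2

/-- Every nonempty set of vertices that is closed under taking parents contains the root. -/
lemma IsArborescence.root_mem (h : IsArborescence G r φ) {S : Set V} (hv : v ∈ S)
    (hS : ∀ w ∈ S, parent φ w ∈ S) : r ∈ S := by
  obtain ⟨n, hn⟩ := h.reach v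
  have key : ∀ n, (parent φ)^[n] v ∈ S := by
    intro n
    induction n with
    | zero => exact hv
    | succ n ih =>
      rw [Function.iterate_succ_apply']
      exact hS _ ih
  exact hn ▸ key n

/-- Two vertices that select the same edge would be each other's parents. -/
lemma IsArborescence.vertex_unique (h : IsArborescence G r φ) (hv : φ v = some (e, y))
    (hw : φ w = some (e, z)) : v = w := by
  rcases (h.isLink hv).eq_and_eq_or_eq_and_eq (h.isLink hw) with ⟨h1, _⟩ | ⟨h1, h2⟩
  · exact h1
  · have hr : r ∈ ({v, w} : Set V) := by
      refine h.root_mem (v := v) (by simp) ?_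
      rintro u (rfl | rfl)
      · rw [parent_of_eq_some hv, h2]; simp
      · rw [parent_of_eq_some hw, ← h1]; simp
    rcases hr with rfl | rfl
    · simp [h.root] at hv
    · simp [h.root] at hw

/-- An arborescence is determined by its set of edges: the vertices at which two arborescences with
the same edges differ are closed under taking parents. -/
lemma IsArborescence.eq_of_chosenEdges_eq (h : IsArborescence G r φ) (h' : IsArborescence G r ψ)
    (hE : chosenEdges φ = chosenEdges ψ) : φ = ψ := by
  by_contra hne
  obtain ⟨v₀, hv₀⟩ := Function.ne_iff.1 hne
  have hr : r ∈ {v | φ v ≠ ψ v} := by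
    refine h.root_mem hv₀ ?_
    intro v hv
    have hvr : v ≠ r := by
      rintro rfl
      exact hv (h.root.trans h'.root.symm)
    obtain ⟨e, y, hφ, hl⟩ := h.link v hvr
    have he : e ∈ chosenEdges ψ := hE ▸ ⟨v, y, hφ⟩
    obtain ⟨w, z, hψ⟩ := he
    have hvw : v ≠ w := by
      rintro rfl
      exact hv (by rw [hφ, hψ, hl.right_unique (h'.isLink hψ)])
    rcases hl.eq_and_eq_or_eq_and_eq (h'.isLink hψ) with ⟨h1, _⟩ | ⟨h1, h2⟩
    · exact absurd h1 hvw
    · rw [parent_of_eq_some hφ, h2]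
      intro hw
      rw [hψ] at hw
      exact hvw (h.vertex_unique hφ hw)
  exact hr (h.root.trans h'.root.symm)

/-- The edges of an arborescence form a spanning tree. A cycle in it would be a set of vertices
that is closed under taking parents, since a cycle has as many edges as vertices. -/
lemma IsArborescence.isSpanningTree (h : IsArborescence G r φ) (hV : V(G) = Set.univ) :
    IsSpanningTree (G.restrict (chosenEdges φ)) G := by
  refine ⟨Graph.restrict_le, rfl, ⟨⟨r, ?_⟩, ?_⟩, ?_⟩
  · simp [hV]
  · have hstep : ∀ v, Relation.ReflTransGen (G.restrict (chosenEdges φ)).Adj v (parent φ v) := by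
      intro v
      rcases eq_or_ne v r with rfl | hv
      · rw [parent_of_eq_none h.root]
      · obtain ⟨e, y, h1, h2⟩ := h.link v hv
        rw [parent_of_eq_some h1]
        exact Relation.ReflTransGen.single ⟨e, ⟨v, y, h1⟩, h2⟩
    have hroot : ∀ v, Relation.ReflTransGen (G.restrict (chosenEdges φ)).Adj v r := by
      intro v
      obtain ⟨n, hn⟩ := h.reach v
      rw [← hn]
      clear hn
      induction n with
      | zero => exact Relation.ReflTransGen.refl
      | succ n ih =>
        rw [Function.iterate_succ_apply']
        exact ih.trans (hstep _)
    intro x _ y _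
    exact (hroot x).trans (Std.Symm.symm _ _ (hroot y))
  · rintro ⟨k, x, e, hx, he, hl⟩
    have hmem : ∀ i, ∃ v y, φ v = some (e i, y) := fun i => (hl i).1
    choose v y hvy using hmem
    have hends : ∀ i, v i ∈ Set.range x ∧ y i ∈ Set.range x := by
      intro i
      rcases (hl i).2.eq_and_eq_or_eq_and_eq (h.isLink (hvy i)) with ⟨h1, h2⟩ | ⟨h1, h2⟩
      · exact ⟨⟨i, h1⟩, ⟨i + 1, h2⟩⟩
      · exact ⟨⟨i + 1, h2⟩, ⟨i, h1⟩⟩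
    choose σ hσ using fun i => (hends i).1
    have hσi : Function.Injective σ := by
      intro i j hij
      have hv : v i = v j := by rw [← hσ i, ← hσ j, hij]
      have h1 := hvy i
      rw [hv, hvy j] at h1
      simp only [Option.some.injEq, Prod.mk.injEq] at h1
      exact (he h1.1).symm
    have hσs := Finite.surjective_of_injective hσi
    have hr : r ∈ Set.range x := by
      refine h.root_mem (v := x 0) ⟨0, rfl⟩ ?_
      rintro _ ⟨j, rfl⟩
      obtain ⟨i, rfl⟩ := hσs j
      rw [hσ, parent_of_eq_some (hvy i)]
      exact (hends i).2
    obtain ⟨j, hj⟩ := hr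
    obtain ⟨i, rfl⟩ := hσs j
    have := hvy i
    rw [← hσ, hj, h.root] at this
    simp at this

/-- A cycle may be given by sequences indexed by the natural numbers. -/
lemma hasCycle_of_nat (n : ℕ) (x : ℕ → V) (e : ℕ → E) (hx : Set.InjOn x (Set.Iic n))
    (he : Set.InjOn e (Set.Iic n)) (hl : ∀ k < n, G.IsLink (e k) (x k) (x (k + 1)))
    (hn : G.IsLink (e n) (x n) (x 0)) : HasCycle G := by
  refine ⟨n, fun i => x i, fun i => e i, ?_, ?_, ?_⟩
  · intro i j hij
    exact Fin.ext (hx (Nat.lt_succ_iff.1 i.2) (Nat.lt_succ_iff.1 j.2) hij)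
  · intro i j hij
    exact Fin.ext (he (Nat.lt_succ_iff.1 i.2) (Nat.lt_succ_iff.1 j.2) hij)
  · intro i
    simp only [Fin.val_add_one]
    split_ifs with hi
    · subst hi
      simpa using hn
    · exact hl i (Nat.lt_of_le_of_ne (Nat.lt_succ_iff.1 i.2) fun h => hi (Fin.ext h))

/-- An edge outside of an arborescence closes a cycle with it: the two paths of parents from its
ends are followed until they first meet. -/
lemma IsArborescence.hasCycle (h : IsArborescence T r φ) {u w : V} (huw : T.IsLink e u w)
    (he : e ∉ chosenEdges φ) : HasCycle T := by
  classical
  set p := parent φ with hp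
  have hpr : p r = r := parent_of_eq_none h.root
  have hex : ∃ n i j, i + j = n ∧ p^[i] u = p^[j] w := by
    obtain ⟨i, hi⟩ := h.reach u
    obtain ⟨j, hj⟩ := h.reach w
    exact ⟨i + j, i, j, rfl, hi.trans hj.symm⟩
  obtain ⟨i, j, hij, hmeet⟩ := Nat.find_spec hex
  -- The meeting point is chosen with `i + j` minimal, which makes all vertices distinct.
  have hmin : ∀ i' j', p^[i'] u = p^[j'] w → i + j ≤ i' + j' := by
    intro i' j' h'
    rw [hij]
    exact Nat.find_min' hex ⟨i', j', rfl, h'⟩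
  have hshift : ∀ (a : V) (m k l : ℕ), p^[k] a = p^[l] a → p^[k + m] a = p^[l + m] a := by
    intro a m k l hkl
    rw [Nat.add_comm k, Nat.add_comm l, Function.iterate_add_apply, hkl,
      ← Function.iterate_add_apply]
  have hu : ∀ k l, k < l → l ≤ i → p^[k] u ≠ p^[l] u := by
    intro k l hkl hl hh
    have h1 := hshift u (i - l) k l hh
    rw [Nat.add_sub_cancel' hl, hmeet] at h1
    have := hmin _ _ h1
    omega
  have hw : ∀ k l, k < l → l ≤ j → p^[k] w ≠ p^[l] w := by
    intro k l hkl hl hh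
    have h1 := hshift w (j - l) k l hh
    rw [Nat.add_sub_cancel' hl, ← hmeet] at h1
    have := hmin _ _ h1.symm
    omega
  have huw' : ∀ k l, k ≤ i → l ≤ j → k + l < i + j → p^[k] u ≠ p^[l] w := by
    intro k l _ _ hlt hh
    have := hmin _ _ hh
    omega
  have hur : ∀ k < i, p^[k] u ≠ r := by
    intro k hk hr
    refine hu k (k + 1) (by omega) (by omega) ?_
    rw [Function.iterate_succ_apply', hr, hpr]
  have hwr : ∀ k < j, p^[k] w ≠ r := by
    intro k hk hr
    refine hw k (k + 1) (by omega) (by omega) ?_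
    rw [Function.iterate_succ_apply', hr, hpr]
  have hedge : ∀ v, ∃ f, v ≠ r → (∃ y, φ v = some (f, y)) ∧ T.IsLink f v (p v) := by
    intro v
    by_cases hv : v = r
    · exact ⟨e, fun h => absurd hv h⟩
    · obtain ⟨f, y, h1, h2⟩ := h.link v hv
      exact ⟨f, fun _ => ⟨⟨y, h1⟩, by rw [hp, parent_of_eq_some h1]; exact h2⟩⟩
  choose f hf using hedge
  have hfinj : ∀ a b, a ≠ r → b ≠ r → f a = f b → a = b := by
    intro a b ha hb hab
    obtain ⟨y, hy⟩ := (hf a ha).1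
    obtain ⟨z, hz⟩ := (hf b hb).1
    rw [← hab] at hz
    exact h.vertex_unique hy hz
  -- `o k` is the vertex that selects the `k`-th edge of the cycle.
  let x : ℕ → V := fun k => if k ≤ i then p^[k] u else p^[i + j - k] w
  let o : ℕ → V := fun k => if k < i then p^[k] u else p^[i + j - k - 1] w
  let c : ℕ → E := fun k => if k < i + j then f (o k) else e
  have hor : ∀ k < i + j, o k ≠ r := by
    intro k hk
    simp only [o]
    split_ifs with h1
    · exact hur k h1
    · exact hwr _ (by omega)
  have hlt : ∀ k l, k < l → l ≤ i + j → x k ≠ x l := by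
    intro k l hkl hl
    simp only [x]
    split_ifs with h1 h2 h2
    · exact hu k l hkl h2
    · exact huw' _ _ h1 (by omega) (by omega)
    · omega
    · exact (hw _ _ (by omega) (by omega)).symm
  have holt : ∀ k l, k < l → l < i + j → o k ≠ o l := by
    intro k l hkl hl
    simp only [o]
    split_ifs with h1 h2 h2
    · exact hu k l hkl h2.le
    · exact huw' _ _ h1.le (by omega) (by omega)
    · omega
    · exact (hw _ _ (by omega) (by omega)).symm
  have hclt : ∀ k l, k < l → l ≤ i + j → c k ≠ c l := by
    intro k l hkl hl
    simp only [c]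
    rw [if_pos (by omega)]
    split_ifs with h2
    · exact fun hh => holt k l hkl h2 (hfinj _ _ (hor _ (by omega)) (hor _ h2) hh)
    · rintro rfl
      obtain ⟨y, hy⟩ := (hf (o k) (hor k (by omega))).1
      exact he ⟨_, _, hy⟩
  refine hasCycle_of_nat (i + j) x c ?_ ?_ ?_ ?_
  · intro k hk l hl hkl
    rcases lt_trichotomy k l with h1 | h1 | h1
    · exact absurd hkl (hlt k l h1 hl)
    · exact h1
    · exact absurd hkl.symm (hlt l k h1 hk)
  · intro k hk l hl hkl
    rcases lt_trichotomy k l with h1 | h1 | h1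
    · exact absurd hkl (hclt k l h1 hl)
    · exact h1
    · exact absurd hkl.symm (hclt l k h1 hk)
  · intro k hk
    have h1 := (hf (o k) (hor k hk)).2
    simp only [c, if_pos hk]
    by_cases hki : k < i
    · have e1 : x k = o k := by simp only [x, o, if_pos hki, if_pos hki.le]
      have e2 : x (k + 1) = p (o k) := by
        simp only [x, o, if_pos hki, if_pos (show k + 1 ≤ i by omega),
          Function.iterate_succ_apply']
      rw [e1, e2]
      exact h1
    · have e1 : x (k + 1) = o k := by
        simp only [x, o, if_neg hki, if_neg (show ¬ k + 1 ≤ i by omega)]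
        congr 1
      have e2 : x k = p (o k) := by
        have e3 : p (o k) = p^[i + j - k] w := by
          simp only [o, if_neg hki]
          rw [← Function.iterate_succ_apply' p]
          congr 1
          omega
        rw [e3]
        simp only [x]
        split_ifs with h2
        · have : k = i := by omega
          subst this
          rw [hmeet]
          congr 1
          omega
        · rfl
      rw [e1, e2]
      exact h1.symm
  · have e1 : x (i + j) = w := by
      simp only [x]
      split_ifs with h2
      · have : j = 0 := by omega
        subst this
        simpa using hmeet
      · simp
    have e2 : x 0 = u := by simp [x]
    have e3 : c (i + j) = e := by simp [c]
    rw [e1, e2, e3]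
    exact huw.symm

/-- In a connected graph, a vertex other than `r` has a neighbour that is closer to `r`. -/
lemma IsConnected.exists_height (hT : IsConnected T) (hV : V(T) = Set.univ) (r : V) :
    ∃ h : V → ℕ, ∀ v, v ≠ r → ∃ w, T.Adj v w ∧ h w < h v := by
  classical
  let P : ℕ → V → Prop := fun n => Nat.rec (motive := fun _ => V → Prop) (fun v => v = r)
    (fun _ Q v => ∃ w, T.Adj v w ∧ Q w) n
  have hP : ∀ v, ∃ n, P n v := by
    intro v
    have := hT.2 v (by simp [hV]) r (by simp [hV])
    induction this using Relation.ReflTransGen.head_induction_on with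
    | refl => exact ⟨0, rfl⟩
    | head hab _ ih =>
      obtain ⟨n, hn⟩ := ih
      exact ⟨n + 1, _, hab, hn⟩
  refine ⟨fun v => Nat.find (hP v), fun v hv => ?_⟩
  have hs := Nat.find_spec (hP v)
  rcases hn : Nat.find (hP v) with _ | n
  · rw [hn] at hs
    exact absurd hs hv
  · rw [hn] at hs
    obtain ⟨w, hw, hPw⟩ := hs
    refine ⟨w, hw, ?_⟩
    simp only [hn]
    exact Nat.lt_succ_of_le (Nat.find_min' (hP w) hPw)

/-- Orienting the edges of a spanning tree towards `r` yields an arborescence. -/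
lemma IsSpanningTree.exists_isArborescence (hT : IsSpanningTree T G) (hV : V(G) = Set.univ)
    (r : V) : ∃ φ, IsArborescence G r φ ∧ G.restrict (chosenEdges φ) = T := by
  classical
  obtain ⟨hTG, hVT, hconn, hcyc⟩ := hT
  obtain ⟨h, hh⟩ := hconn.exists_height (hVT.trans hV) r
  have hex : ∀ v, ∃ q : Option (E × V), (v = r → q = none) ∧
      (v ≠ r → ∃ e y, q = some (e, y) ∧ T.IsLink e v y ∧ h y < h v) := by
    intro v
    by_cases hv : v = r
    · exact ⟨none, fun _ => rfl, fun h => absurd hv h⟩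
    · obtain ⟨w, ⟨e, he⟩, hw⟩ := hh v hv
      exact ⟨some (e, w), fun h => absurd h hv, fun _ => ⟨e, w, rfl, he, hw⟩⟩
  choose φ hφ0 hφ1 using hex
  have hreach : ∀ n v, h v = n → ∃ k, (parent φ)^[k] v = r := by
    intro n
    induction n using Nat.strong_induction_on with
    | _ n ih =>
      intro v hv
      by_cases hvr : v = r
      · exact ⟨0, hvr⟩
      · obtain ⟨e, y, h1, _, h3⟩ := hφ1 v hvr
        obtain ⟨k, hk⟩ := ih (h y) (hv ▸ h3) y rfl
        refine ⟨k + 1, ?_⟩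
        rw [Function.iterate_succ_apply, parent_of_eq_some h1, hk]
  have hφT : IsArborescence T r φ :=
    ⟨hφ0 r rfl, fun v hv => by
      obtain ⟨e, y, h1, h2, _⟩ := hφ1 v hv
      exact ⟨e, y, h1, h2⟩, fun v => hreach _ v rfl⟩
  have hφG : IsArborescence G r φ :=
    ⟨hφT.root, fun v hv => by
      obtain ⟨e, y, h1, h2⟩ := hφT.link v hv
      exact ⟨e, y, h1, h2.mono hTG⟩, hφT.reach⟩
  refine ⟨φ, hφG, Graph.ext hVT.symm ?_⟩
  intro e x y
  constructor
  · rintro ⟨⟨v, z, hv⟩, hl⟩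
    rwa [Graph.IsSubgraph.isLink_iff hTG (hφT.isLink hv).edge_mem]
  · intro hl
    refine ⟨?_, hl.mono hTG⟩
    by_contra he
    exact hcyc (hφT.hasCycle hl he)

/-- Spanning trees correspond to arborescences with a given root. -/
lemma numSpanningTrees_eq_ncard (hV : V(G) = Set.univ) (r : V) :
    numSpanningTrees G = {φ | IsArborescence G r φ}.ncard := by
  have himg : {T : Graph V E | IsSpanningTree T G} =
      (fun φ => G.restrict (chosenEdges φ)) '' {φ | IsArborescence G r φ} := by
    ext T
    constructor
    · intro hT
      obtain ⟨φ, h1, h2⟩ := hT.exists_isArborescence hV r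
      exact ⟨φ, h1, h2⟩
    · rintro ⟨φ, h1, rfl⟩
      exact h1.isSpanningTree hV
  rw [numSpanningTrees, himg, Set.InjOn.ncard_image]
  intro φ hφ ψ hψ hEq
  refine hφ.eq_of_chosenEdges_eq hψ ?_
  have hsub : ∀ {φ : V → Option (E × V)}, IsArborescence G r φ →
      E(G.restrict (chosenEdges φ)) = chosenEdges φ := by
    intro φ hφ
    ext e
    constructor
    · exact fun he => he.2
    · rintro ⟨v, y, hv⟩
      exact ⟨(hφ.isLink hv).edge_mem, v, y, hv⟩
  rw [← hsub hφ, ← hsub hψ]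
  exact congrArg _ hEq

end Arborescence

/-! ### The matrix-tree theorem -/

section MatrixTree

variable {V E : Type*} [Fintype V] [DecidableEq V]

/-- The contribution of a choice at `v` to the row at `v` of the Laplacian matrix: `δ_v - δ_y` for
an edge from `v` to `y`, and `δ_v` if nothing is selected. -/
def choiceRow (v : V) (q : Option (E × V)) : V → ℝ :=
  Pi.single v 1 - q.elim 0 fun h => Pi.single h.2 1

/-- If following parents leads from each vertex to the root, then the matrix is triangular with unit
diagonal once the vertices are ordered by their distance from the root. -/
lemma det_choiceRow_of_reach {φ : V → Option (E × V)} {r : V} (hr : ∀ v, φ v = none ↔ v = r)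
    (h : ∀ v, ∃ n, (parent φ)^[n] v = r) :
    (Matrix.of fun v => choiceRow v (φ v)).det = 1 := by
  let d : V → ℕ := fun v => Nat.find (h v)
  have hd : ∀ v, v ≠ r → d (parent φ v) < d v := by
    intro v hv
    have hs := Nat.find_spec (h v)
    rcases hn : Nat.find (h v) with _ | n
    · rw [hn] at hs
      exact absurd hs hv
    · rw [hn, Function.iterate_succ_apply] at hs
      simp only [d, hn]
      exact Nat.lt_succ_of_le (Nat.find_min' (h (parent φ v)) hs)
  have hentry : ∀ v w, v ≠ w → d v ≤ d w → choiceRow v (φ v) w = 0 := by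
    intro v w hvw hle
    rcases hq : φ v with _ | ⟨e, y⟩
    · simp [choiceRow, hvw.symm]
    · have hvr : v ≠ r := fun hh => by simp [(hr v).2 hh] at hq
      have hy := hd v hvr
      rw [parent_of_eq_some hq] at hy
      have hwy : w ≠ y := by
        rintro rfl
        omega
      simp [choiceRow, hvw.symm, hwy]
  have hdiag : ∀ v, choiceRow v (φ v) v = 1 := by
    intro v
    rcases hq : φ v with _ | ⟨e, y⟩
    · simp [choiceRow]
    · have hvr : v ≠ r := fun hh => by simp [(hr v).2 hh] at hq
      have hy := hd v hvr
      rw [parent_of_eq_some hq] at hy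
      have hwy : v ≠ y := by
        rintro rfl
        omega
      simp [choiceRow, hwy]
  have htri : (Matrix.of fun v => choiceRow v (φ v)).BlockTriangular
      (fun v => OrderDual.toDual (d v)) := by
    intro v w hvw
    have hlt : d v < d w := hvw
    exact hentry v w (by rintro rfl; exact lt_irrefl _ hlt) hlt.le
  rw [htri.det]
  refine Finset.prod_eq_one fun a _ => ?_
  rw [show (Matrix.of fun v => choiceRow v (φ v)).toSquareBlock
    (fun v => OrderDual.toDual (d v)) a = 1 from ?_, Matrix.det_one]
  ext ⟨v, hv⟩ ⟨w, hw⟩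
  simp only [Matrix.toSquareBlock_def, Matrix.of_apply, Matrix.one_apply, Subtype.mk.injEq]
  split_ifs with hvw
  · subst hvw
    exact hdiag v
  · exact hentry v w hvw (le_of_eq (OrderDual.toDual.injective (hv.trans hw.symm)))

/-- If the root is not reached from every vertex, then the indicator function of the vertices that
miss it lies in the kernel. -/
lemma det_choiceRow_of_not_reach {φ : V → Option (E × V)} {r : V} (hr : ∀ v, φ v = none ↔ v = r)
    (h : ¬ ∀ v, ∃ n, (parent φ)^[n] v = r) :
    (Matrix.of fun v => choiceRow v (φ v)).det = 0 := by
  classical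
  push Not at h
  obtain ⟨v₀, hv₀⟩ := h
  let f : V → ℝ := fun v => if ∃ n, (parent φ)^[n] v = r then 0 else 1
  refine Matrix.exists_mulVec_eq_zero_iff.1 ⟨f, ?_, ?_⟩
  · refine Function.ne_iff.2 ⟨v₀, ?_⟩
    simp [f, hv₀]
  · ext v
    have hmul : ((Matrix.of fun v => choiceRow v (φ v)).mulVec f) v
        = f v - (φ v).elim 0 fun h => f h.2 := by
      rcases hq : φ v with _ | ⟨e, y⟩ <;>
        simp [Matrix.mulVec, dotProduct, choiceRow, hq, sub_mul, Finset.sum_sub_distrib,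
          Pi.single_apply]
    rw [hmul]
    rcases hq : φ v with _ | ⟨e, y⟩
    · have : v = r := (hr v).1 hq
      have h0 : f v = 0 := if_pos ⟨0, this⟩
      simp [h0]
    · have hvr : v ≠ r := fun hh => by simp [(hr v).2 hh] at hq
      have hiff : (∃ n, (parent φ)^[n] v = r) ↔ ∃ n, (parent φ)^[n] y = r := by
        constructor
        · rintro ⟨n, hn⟩
          rcases n with _ | n
          · exact absurd hn hvr
          · exact ⟨n, by rwa [Function.iterate_succ_apply, parent_of_eq_some hq] at hn⟩
        · rintro ⟨n, hn⟩
          exact ⟨n + 1, by rwa [Function.iterate_succ_apply, parent_of_eq_some hq]⟩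
      simp only [f, hiff, Option.elim_some, sub_self, Pi.zero_apply]

/-- The rows of the Laplacian matrix are sums over the incident edges. -/
lemma toMatrix'_laplacian_row [Fintype E] [DecidableEq E] (G : Graph V E)
    [∀ e x y, Decidable (G.IsLink e x y)] (v : V) :
    (LinearMap.toMatrix' (laplacian G)) v =
      ∑ h : E × V with G.IsLink h.1 v h.2, choiceRow v (some h) := by
  ext w
  rw [LinearMap.toMatrix'_apply, Finset.sum_apply, Finset.sum_filter, ← Finset.univ_product_univ,
    Finset.sum_product_right]
  simp only [laplacian, LinearMap.coe_mk, AddHom.coe_mk]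
  refine Finset.sum_congr rfl fun y _ => ?_
  have hcard : ({e | G.IsLink e v y} : Set E).ncard
      = (Finset.univ.filter fun e => G.IsLink e v y).card := by
    rw [← Set.ncard_coe_finset]
    congr 1
    ext e
    simp
  rw [hcard, ← Finset.sum_filter]
  simp [choiceRow, Pi.single_apply, eq_comm, mul_sub]

/-- Replacing the row of the Laplacian at `r` by `δ_r` gives a matrix whose determinant is the
number of arborescences rooted at `r`: the determinant is expanded over the choice of one incident
edge in each of the other rows. -/
lemma det_updateRow_laplacian [Fintype E] (G : Graph V E) (hV : V(G) = Set.univ) (r : V) :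
    ((LinearMap.toMatrix' (laplacian G)).updateRow r (Pi.single r 1)).det
      = numSpanningTrees G := by
  classical
  let A : V → Finset (Option (E × V)) := fun v =>
    if v = r then {none} else
      (Finset.univ.filter fun h : E × V => G.IsLink h.1 v h.2).map Function.Embedding.some
  have hrows : (LinearMap.toMatrix' (laplacian G)).updateRow r (Pi.single r 1)
      = fun v => ∑ q ∈ A v, choiceRow v q := by
    ext1 v
    by_cases hv : v = r
    · subst hv
      simp [A, choiceRow]
    · rw [Matrix.updateRow_ne hv, toMatrix'_laplacian_row]
      simp [A, hv]
  have hA : ∀ {φ : V → Option (E × V)}, φ ∈ Fintype.piFinset A →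
      φ r = none ∧ ∀ v, v ≠ r → ∃ e y, φ v = some (e, y) ∧ G.IsLink e v y := by
    intro φ hφ
    rw [Fintype.mem_piFinset] at hφ
    refine ⟨by simpa [A] using hφ r, fun v hv => ?_⟩
    have := hφ v
    simp only [A, if_neg hv, Finset.mem_map, Finset.mem_filter, Finset.mem_univ, true_and,
      Function.Embedding.some_apply] at this
    obtain ⟨⟨e, y⟩, h1, h2⟩ := this
    exact ⟨e, y, h2.symm, h1⟩
  have hset : {φ | IsArborescence G r φ}
      = ((Fintype.piFinset A).filter fun φ => ∀ v, ∃ n, (parent φ)^[n] v = r : Set _) := by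
    ext φ
    simp only [Finset.coe_filter, Set.mem_ofPred_eq]
    constructor
    · intro h
      refine ⟨Fintype.mem_piFinset.2 fun v => ?_, h.reach⟩
      by_cases hv : v = r
      · subst hv
        simp [A, h.root]
      · obtain ⟨e, y, h1, h2⟩ := h.link v hv
        simp [A, hv, h1, h2]
    · rintro ⟨h1, h2⟩
      exact ⟨(hA h1).1, (hA h1).2, h2⟩
  rw [numSpanningTrees_eq_ncard hV r, hset, Set.ncard_coe_finset, hrows]
  change Matrix.detRowAlternating.toMultilinearMap _ = _
  rw [MultilinearMap.map_sum_finset, Finset.card_filter, Nat.cast_sum]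
  refine Finset.sum_congr rfl fun φ hφ => ?_
  have hr : ∀ v, φ v = none ↔ v = r := by
    intro v
    constructor
    · intro hv
      by_contra hvr
      obtain ⟨e, y, h1, _⟩ := (hA hφ).2 v hvr
      simp [hv] at h1
    · rintro rfl
      exact (hA hφ).1
  split_ifs with h
  · rw [Nat.cast_one]
    exact det_choiceRow_of_reach hr h
  · rw [Nat.cast_zero]
    exact det_choiceRow_of_not_reach hr h

/-- The **matrix-tree theorem**: up to sign, the linear coefficient of the characteristic polynomial
of the Laplacian is the number of spanning trees times the number of vertices. All principal minors
of size `|V| - 1` equal the number of spanning trees. -/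
theorem charpoly_laplacian_coeff_one [Fintype E] [Nonempty V] (G : Graph V E)
    (hV : V(G) = Set.univ) :
    (laplacian G).charpoly.coeff 1
      = (-1) ^ (Fintype.card V - 1) * (Fintype.card V * numSpanningTrees G) := by
  classical
  have hpos : 1 ≤ Fintype.card V := Fintype.card_pos
  have hchar : (laplacian G).charpoly = (LinearMap.toMatrix' (laplacian G)).charpoly := by
    rw [← LinearMap.charpoly_toMatrix (laplacian G) (Pi.basisFun ℝ V),
      LinearMap.toMatrix_eq_toMatrix']
  have hminors := Matrix.charpoly_coeff_eq_sum_minors (LinearMap.toMatrix' (laplacian G))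
    (Fintype.card V - 1) (Nat.sub_le _ _)
  rw [Nat.sub_sub_self hpos] at hminors
  rw [hchar, hminors]
  congr 1
  have himg : (Finset.univ : Finset V).powersetCard (Fintype.card V - 1)
      = Finset.univ.image fun r : V => Finset.univ.erase r := by
    ext s
    simp only [Finset.mem_powersetCard, Finset.subset_univ, true_and, Finset.mem_image,
      Finset.mem_univ]
    constructor
    · intro hs
      have hc : sᶜ.card = 1 := by
        rw [Finset.card_compl, hs]
        omega
      obtain ⟨r, hr⟩ := Finset.card_eq_one.1 hc
      refine ⟨r, ?_⟩
      rw [← compl_compl s, hr]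
      ext; simp
    · rintro ⟨r, rfl⟩
      simp [Finset.card_erase_of_mem]
  rw [himg, Finset.sum_image]
  · have hterm : ∀ r : V, ((LinearMap.toMatrix' (laplacian G)).submatrix
        (Subtype.val : ((Finset.univ : Finset V).erase r) → V) Subtype.val).det
        = numSpanningTrees G := by
      intro r
      rw [← Matrix.det_piecewise_one_eq_submatrix_det, ← det_updateRow_laplacian G hV r]
      congr 1
      ext v w
      by_cases hv : v = r
      · subst hv
        simp [Finset.piecewise, Matrix.row, Matrix.one_apply, Pi.single_apply, eq_comm]
      · simp [Finset.piecewise, Matrix.row, hv]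
    rw [Finset.sum_congr rfl fun r _ => hterm r]
    simp
  · intro r _ s _ hrs
    by_contra hne
    have : r ∈ Finset.univ.erase s := by simp [hne]
    simp only at hrs
    rw [← hrs] at this
    simp at this

end MatrixTree

/-! ### The spectrum of a circulant graph -/

section Spectrum

/-- The eigenvalue `∑_m (2 - 2 cos (2 π k g_m / N))` of the Laplacian of the circulant graph
`C_N^{g_1, …, g_d}` that belongs to the `k`-th character of `ℤ/Nℤ`. -/
noncomputable def eigval (N : ℕ) {d : ℕ} (g : Fin d → ℕ) (k : ℕ) : ℝ :=
  ∑ m, (2 - 2 * Real.cos (2 * Real.pi * k * g m / N))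

lemma laplacian_circulant_apply (N : ℕ) [NeZero N] {d : ℕ} (g : Fin d → ℕ) (f : ZMod N → ℝ)
    (x : ZMod N) :
    laplacian (circulant N g) f x = ∑ m, (2 * f x - f (x + g m) - f (x - g m)) := by
  classical
  have hterm : ∀ y, ({e | (circulant N g).IsLink e x y}.ncard : ℝ) * (f x - f y)
      = ∑ m, ((if y = x + g m then f x - f y else 0)
        + (if y = x - g m then f x - f y else 0)) := by
    intro y
    rcases eq_or_ne x y with rfl | hxy
    · simp
    have hcard : ({e | (circulant N g).IsLink e x y} : Set _).ncard
        = (Finset.univ.filter fun e : ZMod N × Fin d =>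
          (x = e.1 ∧ y = e.1 + (g e.2 : ZMod N)) ∨
            (x = e.1 + (g e.2 : ZMod N) ∧ y = e.1)).card := by
      rw [← Set.ncard_coe_finset]
      congr 1
      ext e
      simp [circulant]
    rw [hcard, Finset.card_filter, ← Finset.univ_product_univ, Finset.sum_product_right]
    push_cast
    rw [Finset.sum_mul]
    refine Finset.sum_congr rfl fun m _ => ?_
    have hsplit : ∀ v : ZMod N, (if (x = v ∧ y = v + (g m : ZMod N)) ∨
        (x = v + (g m : ZMod N) ∧ y = v) then (1 : ℝ) else 0)
        = (if x = v then (if y = x + g m then 1 else 0) else 0)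
          + (if y = v then (if y = x - g m then 1 else 0) else 0) := by
      intro v
      by_cases h1 : x = v
      · subst h1
        simp [hxy.symm]
      · by_cases h2 : y = v
        · subst h2
          simp [h1, eq_sub_iff_add_eq, eq_comm]
        · simp [h1, h2]
    rw [Finset.sum_congr rfl fun v _ => hsplit v, Finset.sum_add_distrib]
    simp only [Finset.sum_ite_eq, Finset.mem_univ, if_true, add_mul, ite_mul, one_mul, zero_mul]
  simp only [laplacian, LinearMap.coe_mk, AddHom.coe_mk]
  rw [Finset.sum_congr rfl fun y _ => hterm y, Finset.sum_comm]
  refine Finset.sum_congr rfl fun m _ => ?_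
  rw [Finset.sum_add_distrib]
  simp only [Finset.sum_ite_eq', Finset.mem_univ, if_true]
  ring

/-- The Laplacian of a circulant graph on complex functions. -/
noncomputable def complexLaplacian (N : ℕ) {d : ℕ} (g : Fin d → ℕ) :
    (ZMod N → ℂ) →ₗ[ℂ] (ZMod N → ℂ) where
  toFun f x := ∑ m, (2 * f x - f (x + g m) - f (x - g m))
  map_add' f h := by
    funext x
    simp only [Pi.add_apply, ← Finset.sum_add_distrib]
    exact Finset.sum_congr rfl fun m _ => by ring
  map_smul' c f := by
    funext x
    simp only [Pi.smul_apply, smul_eq_mul, RingHom.id_apply, Finset.mul_sum]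
    exact Finset.sum_congr rfl fun m _ => by ring

open ZMod in
lemma dft_translate (N : ℕ) [NeZero N] (f : ZMod N → ℂ) (a k : ZMod N) :
    dft (fun x => f (x + a)) k = stdAddChar (a * k) * dft f k := by
  simp only [dft_apply, smul_eq_mul, Finset.mul_sum]
  refine Fintype.sum_equiv (Equiv.addRight a) _ _ fun x => ?_
  rw [← mul_assoc, ← AddChar.map_add_eq_mul]
  simp only [Equiv.coe_addRight]
  congr 2
  ring

open ZMod in
lemma stdAddChar_add_stdAddChar_neg (N : ℕ) [NeZero N] (a : ℕ) (k : ZMod N) :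
    stdAddChar ((a : ZMod N) * k) + stdAddChar (-(a : ZMod N) * k)
      = ((2 * Real.cos (2 * Real.pi * k.val * a / N) : ℝ) : ℂ) := by
  have h1 : (a : ZMod N) * k = (((a * k.val : ℕ) : ℤ) : ZMod N) := by
    push_cast
    rw [ZMod.natCast_zmod_val]
  have h2 : -(a : ZMod N) * k = ((-((a * k.val : ℕ) : ℤ) : ℤ) : ZMod N) := by
    push_cast
    rw [ZMod.natCast_zmod_val]
    ring
  rw [h1, h2, stdAddChar_coe, stdAddChar_coe]
  push_cast
  rw [Complex.two_cos]
  congr 2 <;> ring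

/-- The Fourier transform turns the Laplacian into multiplication by the eigenvalues. -/
lemma dft_complexLaplacian (N : ℕ) [NeZero N] {d : ℕ} (g : Fin d → ℕ) (f : ZMod N → ℂ)
    (k : ZMod N) :
    ZMod.dft (complexLaplacian N g f) k = (eigval N g k.val : ℂ) * ZMod.dft f k := by
  have hsum : complexLaplacian N g f = ∑ m : Fin d,
      ((2 : ℂ) • f - (fun x => f (x + (g m : ZMod N))) - fun x => f (x + -(g m : ZMod N))) := by
    funext x
    simp [complexLaplacian, sub_eq_add_neg]
  rw [hsum, map_sum, Finset.sum_apply, eigval, Complex.ofReal_sum, Finset.sum_mul]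
  refine Finset.sum_congr rfl fun m _ => ?_
  rw [map_sub, map_sub, map_smul, Pi.sub_apply, Pi.sub_apply, dft_translate, dft_translate,
    Pi.smul_apply, smul_eq_mul, Complex.ofReal_sub, ← stdAddChar_add_stdAddChar_neg]
  push_cast
  ring

lemma prod_zmod_val {M : Type*} [CommMonoid M] (N : ℕ) [NeZero N] (F : ℕ → M) :
    ∏ k : ZMod N, F k.val = ∏ k ∈ Finset.range N, F k := by
  refine Finset.prod_nbij ZMod.val (fun k _ => Finset.mem_range.2 k.val_lt)
    (fun a _ b _ h => ZMod.val_injective N h) (fun k hk => ?_) fun _ _ => rfl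
  exact ⟨k, by simp, ZMod.val_cast_of_lt (Finset.mem_range.1 hk)⟩

theorem charpoly_laplacian_circulant (N : ℕ) [NeZero N] {d : ℕ} (g : Fin d → ℕ) :
    (laplacian (circulant N g)).charpoly
      = ∏ k ∈ Finset.range N, (Polynomial.X - Polynomial.C (eigval N g k)) := by
  classical
  apply Polynomial.map_injective Complex.ofRealHom Complex.ofReal_injective
  have hdiag : ZMod.dft.conj (complexLaplacian N g)
      = Matrix.toLin' (Matrix.diagonal fun k : ZMod N => (eigval N g k.val : ℂ)) := by
    apply LinearMap.ext
    intro f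
    funext k
    rw [LinearEquiv.conj_apply_apply, dft_complexLaplacian, LinearEquiv.apply_symm_apply,
      Matrix.toLin'_apply, Matrix.mulVec_diagonal]
  have hcomplex : (LinearMap.toMatrix' (laplacian (circulant N g))).map Complex.ofRealHom
      = LinearMap.toMatrix' (complexLaplacian N g) := by
    ext x y
    rw [Matrix.map_apply, LinearMap.toMatrix'_apply, LinearMap.toMatrix'_apply,
      laplacian_circulant_apply]
    have hs : ∀ z, Complex.ofRealHom ((Pi.single y 1 : ZMod N → ℝ) z)
        = (Pi.single y 1 : ZMod N → ℂ) z := by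
      intro z
      rcases eq_or_ne z y with rfl | hz
      · simp
      · simp [hz]
    simp only [map_sum, map_sub, map_mul, hs, complexLaplacian, LinearMap.coe_mk, AddHom.coe_mk,
      map_ofNat]
  rw [← LinearMap.charpoly_toMatrix (laplacian (circulant N g)) (Pi.basisFun ℝ _),
    LinearMap.toMatrix_eq_toMatrix', ← Matrix.charpoly_map, hcomplex,
    ← LinearMap.toMatrix_eq_toMatrix', LinearMap.charpoly_toMatrix,
    ← LinearEquiv.charpoly_conj ZMod.dft, hdiag,
    ← LinearMap.charpoly_toMatrix _ (Pi.basisFun ℂ _), LinearMap.toMatrix_eq_toMatrix',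
    LinearMap.toMatrix'_toLin', Matrix.charpoly_diagonal, Polynomial.map_prod,
    ← prod_zmod_val]
  simp

theorem numSpanningTrees_circulant (N : ℕ) [NeZero N] {d : ℕ} (g : Fin d → ℕ) :
    (N : ℝ) * numSpanningTrees (circulant N g) = ∏ k ∈ Finset.Ico 1 N, eigval N g k := by
  have hN : 0 < N := Nat.pos_of_ne_zero (NeZero.ne N)
  have h1 := charpoly_laplacian_coeff_one (circulant N g) rfl
  rw [charpoly_laplacian_circulant, Finset.prod_range_eq_mul_Ico _ hN, ZMod.card] at h1
  have h0 : eigval N g 0 = 0 := by simp [eigval]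
  rw [h0, Polynomial.C_0, sub_zero, Polynomial.coeff_X_mul, Polynomial.coeff_zero_eq_eval_zero,
    Polynomial.eval_prod] at h1
  simp only [Polynomial.eval_sub, Polynomial.eval_X, Polynomial.eval_C, zero_sub] at h1
  rw [Finset.prod_neg, Nat.card_Ico] at h1
  exact (mul_left_cancel₀ (pow_ne_zero _ (by norm_num)) h1).symm

end Spectrum

/-! ### Products over the eigenvalues and the tree entropy -/

section Entropy

open Filter Topology

/-- A product of chord lengths: with `v = e^{iφ}`, the factor `2 cosh θ - 2 cos φ` is
`(e^θ - v) (1 - e^{-θ} v⁻¹)`, and `φ` runs over the angles with a given value of `n φ`. -/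
lemma prod_two_cosh_sub_two_cos {n : ℕ} (hn : 0 < n) (θ α : ℝ) :
    ∏ l ∈ Finset.range n, (2 * Real.cosh θ - 2 * Real.cos (α + 2 * Real.pi * l / n))
      = 2 * Real.cosh (n * θ) - 2 * Real.cos (n * α) := by
  have hroots : ∀ {ζ : ℂ}, IsPrimitiveRoot ζ n → ∀ z u : ℂ,
      ∏ l ∈ Finset.range n, (z - ζ ^ l * u) = z ^ n - u ^ n := by
    intro ζ hζ z u
    have h := X_pow_sub_C_eq_prod hζ hn (rfl : u ^ n = u ^ n)
    apply_fun Polynomial.eval z at h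
    simpa [Polynomial.eval_prod] using h.symm
  have hζ : IsPrimitiveRoot (Complex.exp (2 * Real.pi * Complex.I / n)) n :=
    Complex.isPrimitiveRoot_exp n hn.ne'
  have hfactor : ∀ x y : ℝ, ((2 * Real.cosh x - 2 * Real.cos y : ℝ) : ℂ)
      = (Complex.exp x - Complex.exp (y * Complex.I))
        * (1 - Complex.exp (-(x : ℂ)) * Complex.exp (-(y * Complex.I))) := by
    intro x y
    have h1 : Complex.exp x * Complex.exp (-(x : ℂ)) = 1 := by
      rw [← Complex.exp_add]; simp
    have h2 : Complex.exp (y * Complex.I) * Complex.exp (-(y * Complex.I)) = 1 := by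
      rw [← Complex.exp_add]; simp
    push_cast
    rw [Complex.two_cosh, Complex.two_cos, ← neg_mul]
    rw [← neg_mul] at h2
    linear_combination (Complex.exp (-(y : ℂ) * Complex.I)) * h1
      - Complex.exp (-(x : ℂ)) * h2
  apply Complex.ofReal_injective
  rw [Complex.ofReal_prod, Finset.prod_congr rfl fun l _ => hfactor _ _,
    Finset.prod_mul_distrib, hfactor]
  have e1 : ∀ l : ℕ, Complex.exp (((α + 2 * Real.pi * l / n : ℝ) : ℂ) * Complex.I)
      = Complex.exp (2 * Real.pi * Complex.I / n) ^ l * Complex.exp (α * Complex.I) := by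
    intro l
    rw [← Complex.exp_nat_mul, ← Complex.exp_add]
    congr 1
    push_cast
    ring
  have e2 : ∀ l : ℕ, Complex.exp (-(θ : ℂ))
        * Complex.exp (-(((α + 2 * Real.pi * l / n : ℝ) : ℂ) * Complex.I))
      = (Complex.exp (2 * Real.pi * Complex.I / n))⁻¹ ^ l
        * Complex.exp (-(θ : ℂ) - α * Complex.I) := by
    intro l
    rw [← Complex.exp_neg (2 * Real.pi * Complex.I / n), ← Complex.exp_nat_mul,
      ← Complex.exp_add, ← Complex.exp_add]
    congr 1
    push_cast
    ring
  simp only [e1, e2]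
  rw [hroots hζ, hroots hζ.inv, one_pow, ← Complex.exp_nat_mul, ← Complex.exp_nat_mul,
    ← Complex.exp_nat_mul, ← Complex.exp_add]
  push_cast
  ring_nf

/-- The product of the nonzero Laplacian eigenvalues of the cycle `C_n`. -/
lemma prod_two_sub_two_cos {n : ℕ} (hn : 0 < n) :
    ∏ l ∈ Finset.Ico 1 n, (2 - 2 * Real.cos (2 * Real.pi * l / n)) = (n : ℝ) ^ 2 := by
  obtain ⟨m, rfl⟩ : ∃ m, n = m + 1 := ⟨n - 1, by omega⟩
  have hζ : IsPrimitiveRoot (Complex.exp (2 * Real.pi * Complex.I / (m + 1 : ℕ))) (m + 1) :=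
    Complex.isPrimitiveRoot_exp _ hn.ne'
  set ζ := Complex.exp (2 * Real.pi * Complex.I / (m + 1 : ℕ)) with hζdef
  have hfactor : ∀ l : ℕ, ((2 - 2 * Real.cos (2 * Real.pi * l / (m + 1 : ℕ)) : ℝ) : ℂ)
      = (1 - ζ ^ l) * (1 - ζ⁻¹ ^ l) := by
    intro l
    have h0 : ζ ≠ 0 := Complex.exp_ne_zero _
    have h1 : ζ ^ l * ζ⁻¹ ^ l = 1 := by rw [← mul_pow, mul_inv_cancel₀ h0, one_pow]
    have h2 : ((2 * Real.cos (2 * Real.pi * l / (m + 1 : ℕ)) : ℝ) : ℂ) = ζ ^ l + ζ⁻¹ ^ l := by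
      rw [hζdef, ← Complex.exp_neg, ← Complex.exp_nat_mul, ← Complex.exp_nat_mul]
      push_cast
      rw [Complex.two_cos]
      congr 2 <;> ring
    rw [Complex.ofReal_sub, h2]
    push_cast
    linear_combination -h1
  apply Complex.ofReal_injective
  rw [Complex.ofReal_prod, Finset.prod_congr rfl fun l _ => hfactor l, Finset.prod_mul_distrib,
    Finset.prod_Ico_eq_prod_range, Finset.prod_Ico_eq_prod_range]
  simp only [Nat.add_sub_cancel, Nat.add_comm 1]
  rw [hζ.prod_one_sub_pow_eq_order, hζ.inv.prod_one_sub_pow_eq_order]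
  push_cast
  ring

lemma prod_range_mul_eq {M : Type*} [CommMonoid M] (b n : ℕ) (F : ℕ → M) :
    ∏ j ∈ Finset.range (b * n), F j
      = ∏ k ∈ Finset.range b, ∏ l ∈ Finset.range n, F (k + b * l) := by
  rw [Finset.prod_comm]
  induction n with
  | zero => simp
  | succ n ih =>
    rw [Nat.mul_succ, Finset.prod_range_add, ih, Finset.prod_range_succ]
    congr 1
    exact Finset.prod_congr rfl fun k _ => by rw [add_comm]

/-- The product over the residues `1, …, b n - 1`, sorted by their remainders modulo `b`. -/
lemma prod_Ico_mul_eq {M : Type*} [CommMonoid M] {b n : ℕ} (hb : 0 < b) (hn : 0 < n)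
    (F : ℕ → M) :
    ∏ j ∈ Finset.Ico 1 (b * n), F j
      = (∏ l ∈ Finset.Ico 1 n, F (b * l))
        * ∏ k ∈ Finset.Ico 1 b, ∏ l ∈ Finset.range n, F (k + b * l) := by
  have hne : ∀ j : ℕ, j ≠ 0 → Function.update F 0 1 j = F j :=
    fun j hj => Function.update_of_ne hj _ _
  have h := prod_range_mul_eq b n (Function.update F 0 1)
  rw [Finset.prod_range_eq_mul_Ico _ (Nat.mul_pos hb hn), Finset.prod_range_eq_mul_Ico _ hb,
    Finset.prod_range_eq_mul_Ico _ hn] at h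
  simp only [Function.update_self, one_mul, mul_zero, add_zero, zero_add] at h
  have hpos : ∀ {j m : ℕ}, j ∈ Finset.Ico 1 m → 0 < j := fun hj => (Finset.mem_Ico.1 hj).1
  have h1 : ∏ j ∈ Finset.Ico 1 (b * n), Function.update F 0 1 j = ∏ j ∈ Finset.Ico 1 (b * n), F j :=
    Finset.prod_congr rfl fun j hj => hne j (hpos hj).ne'
  have h2 : ∏ l ∈ Finset.Ico 1 n, Function.update F 0 1 (b * l) = ∏ l ∈ Finset.Ico 1 n, F (b * l) :=
    Finset.prod_congr rfl fun l hl => hne _ (Nat.mul_pos hb (hpos hl)).ne'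
  have h3 : ∏ k ∈ Finset.Ico 1 b, ∏ l ∈ Finset.range n, Function.update F 0 1 (k + b * l)
      = ∏ k ∈ Finset.Ico 1 b, ∏ l ∈ Finset.range n, F (k + b * l) :=
    Finset.prod_congr rfl fun k hk => Finset.prod_congr rfl fun l _ =>
      hne _ (Nat.add_pos_left (hpos hk) _).ne'
  rwa [h1, h2, h3] at h

/-- The number `1 + μ_k / 2`, the hyperbolic cosine of the `k`-th growth rate. -/
noncomputable def coshRate (β : ℕ) {r : ℕ} (γ : Fin r → ℕ) (k : ℕ) : ℝ :=
  1 + ∑ m, (1 - Real.cos (2 * Real.pi * k * γ m / β))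

lemma one_le_coshRate (β : ℕ) {r : ℕ} (γ : Fin r → ℕ) (k : ℕ) : 1 ≤ coshRate β γ k := by
  have : 0 ≤ ∑ m, (1 - Real.cos (2 * Real.pi * k * γ m / β)) :=
    Finset.sum_nonneg fun m _ => sub_nonneg.2 (Real.cos_le_one _)
  unfold coshRate
  linarith

/-- The eigenvalues of `C_{β n}^{1, γ_1 n, …}`: the contribution of the long edges depends only on
the index modulo `β`. -/
lemma eigval_nonFixed {β n : ℕ} (hβ : 0 < β) (hn : 0 < n) {r : ℕ} (γ : Fin r → ℕ) (k l : ℕ) :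
    eigval (β * n) (Fin.cons 1 fun m => γ m * n : Fin (r + 1) → ℕ) (k + β * l)
      = 2 * coshRate β γ k
        - 2 * Real.cos (2 * Real.pi * k / (β * n) + 2 * Real.pi * l / n) := by
  have hβ0 : (β : ℝ) ≠ 0 := by exact_mod_cast hβ.ne'
  have hn0 : (n : ℝ) ≠ 0 := by exact_mod_cast hn.ne'
  rw [eigval, Fin.sum_univ_succ]
  simp only [Fin.cons_zero, Fin.cons_succ]
  have h1 : (2 * Real.pi * ((k + β * l : ℕ) : ℝ) * ((1 : ℕ) : ℝ) / ((β * n : ℕ) : ℝ))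
      = 2 * Real.pi * k / (β * n) + 2 * Real.pi * l / n := by
    push_cast
    field_simp
  have h2 : ∀ m, Real.cos (2 * Real.pi * ((k + β * l : ℕ) : ℝ) * ((γ m * n : ℕ) : ℝ)
      / ((β * n : ℕ) : ℝ)) = Real.cos (2 * Real.pi * k * γ m / β) := by
    intro m
    rw [← Real.cos_add_nat_mul_two_pi (2 * Real.pi * k * γ m / β) (l * γ m)]
    congr 1
    push_cast
    field_simp
  simp only [h1, h2]
  rw [coshRate, mul_add, Finset.mul_sum]
  simp only [mul_sub, mul_one]
  ring

/-- A closed form of the number of spanning trees. -/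
theorem numSpanningTrees_nonFixed {β n : ℕ} (hβ : 0 < β) (hn : 0 < n) {r : ℕ} (γ : Fin r → ℕ) :
    (β : ℝ) * n * numSpanningTrees (nonFixedCirculant β γ n)
      = (n : ℝ) ^ 2 * ∏ k ∈ Finset.Ico 1 β,
        (2 * Real.cosh (n * Real.arcosh (coshRate β γ k)) - 2 * Real.cos (2 * Real.pi * k / β)) := by
  have : NeZero (β * n) := ⟨(Nat.mul_pos hβ hn).ne'⟩
  have hβ0 : (β : ℝ) ≠ 0 := by exact_mod_cast hβ.ne'
  have hn0 : (n : ℝ) ≠ 0 := by exact_mod_cast hn.ne'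
  have h := numSpanningTrees_circulant (β * n) (Fin.cons 1 fun m => γ m * n : Fin (r + 1) → ℕ)
  rw [prod_Ico_mul_eq hβ hn] at h
  rw [nonFixedCirculant, ← Nat.cast_mul, h]
  congr 1
  · rw [← prod_two_sub_two_cos hn]
    refine Finset.prod_congr rfl fun l _ => ?_
    have := eigval_nonFixed hβ hn γ 0 l
    rw [zero_add] at this
    rw [this]
    simp [coshRate]
  · refine Finset.prod_congr rfl fun k _ => ?_
    rw [Finset.prod_congr rfl fun l _ => eigval_nonFixed hβ hn γ k l]
    have := prod_two_cosh_sub_two_cos hn (Real.arcosh (coshRate β γ k))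
      (2 * Real.pi * k / (β * n))
    rw [Real.cosh_arcosh (one_le_coshRate β γ k)] at this
    rw [this]
    congr 3
    field_simp

lemma two_cosh_sub_two_mul_bounds {x c : ℝ} (hx : 0 ≤ x) (hc : -1 ≤ c) (hc1 : c < 1) :
    (1 - c) / 2 * Real.exp x ≤ 2 * Real.cosh x - 2 * c ∧
      2 * Real.cosh x - 2 * c ≤ 4 * Real.exp x := by
  have h1 := Real.one_le_cosh x
  have h2 : 2 * Real.cosh x = Real.exp x + Real.exp (-x) := by
    rw [Real.cosh_eq]; ring
  have h3 := Real.exp_pos (-x)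
  have h4 : Real.exp (-x) ≤ 1 := Real.exp_le_one_iff.2 (by linarith)
  have h5 : 1 ≤ Real.exp x := Real.one_le_exp hx
  constructor
  · nlinarith
  · linarith

/-- The exponential growth rate of each factor. -/
lemma tendsto_log_two_cosh_div {θ c : ℝ} (hθ : 0 ≤ θ) (hc : -1 ≤ c) (hc1 : c < 1) :
    Tendsto (fun n : ℕ => Real.log (2 * Real.cosh (n * θ) - 2 * c) / n) atTop (𝓝 θ) := by
  have hlim : ∀ a : ℝ, Tendsto (fun n : ℕ => θ + a / n) atTop (𝓝 θ) := by
    intro a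
    simpa using (tendsto_const_nhds (x := θ)).add (tendsto_const_div_atTop_nhds_zero_nat a)
  refine tendsto_of_tendsto_of_tendsto_of_le_of_le' (hlim (Real.log ((1 - c) / 2)))
    (hlim (Real.log 4)) ?_ ?_
  · filter_upwards [eventually_gt_atTop 0] with n hn
    have hn0 : (0 : ℝ) < n := by exact_mod_cast hn
    have hb := (two_cosh_sub_two_mul_bounds (x := n * θ) (by positivity) hc hc1).1
    have hpos : 0 < (1 - c) / 2 := by linarith
    have := Real.log_le_log (by positivity) hb
    rw [Real.log_mul hpos.ne' (Real.exp_pos _).ne', Real.log_exp] at this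
    rw [le_div_iff₀ hn0, add_mul, div_mul_cancel₀ _ hn0.ne']
    linarith
  · filter_upwards [eventually_gt_atTop 0] with n hn
    have hn0 : (0 : ℝ) < n := by exact_mod_cast hn
    have hb := two_cosh_sub_two_mul_bounds (x := n * θ) (by positivity) hc hc1
    have hpos : 0 < (1 - c) / 2 := by linarith
    have := Real.log_le_log (lt_of_lt_of_le (by positivity) hb.1) hb.2
    rw [Real.log_mul (by norm_num) (Real.exp_pos _).ne', Real.log_exp] at this
    rw [div_le_iff₀ hn0, add_mul, div_mul_cancel₀ _ hn0.ne']
    linarith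

lemma cos_two_pi_mul_div_lt_one {k b : ℕ} (hk : 1 ≤ k) (hkb : k < b) :
    Real.cos (2 * Real.pi * k / b) < 1 := by
  have hb0 : (0 : ℝ) < b := by exact_mod_cast lt_trans hk hkb
  have hk0 : (0 : ℝ) < k := by exact_mod_cast hk
  have hkb' : (k : ℝ) < b := by exact_mod_cast hkb
  have hpi := Real.pi_pos
  refine lt_of_le_of_ne (Real.cos_le_one _) fun h => ?_
  have hlt : 2 * Real.pi * k / b < 2 * Real.pi := by
    rw [div_lt_iff₀ hb0]
    nlinarith
  have hpos : 0 < 2 * Real.pi * k / b := by positivity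
  have := (Real.cos_eq_one_iff_of_lt_of_lt (by linarith) hlt).1 h
  linarith

theorem hasTreeEntropy_nonFixed {β : ℕ} (hβ : 0 < β) {r : ℕ} (γ : Fin r → ℕ) :
    HasTreeEntropy (fun n => nonFixedCirculant β γ n)
      ((1 / (β : ℝ)) * ∑ k ∈ Finset.Ico 1 β, Real.arcosh (coshRate β γ k)) := by
  have hβ0 : (0 : ℝ) < β := by exact_mod_cast hβ
  have hcard : ∀ n, (V(nonFixedCirculant β γ n).ncard : ℝ) = β * n := by
    intro n
    have : V(nonFixedCirculant β γ n) = Set.univ := rfl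
    rw [this, Set.ncard_univ, Nat.card_zmod]
    push_cast
    rfl
  unfold HasTreeEntropy
  simp only [hcard]
  let Q : ℕ → ℕ → ℝ := fun k n =>
    2 * Real.cosh (n * Real.arcosh (coshRate β γ k)) - 2 * Real.cos (2 * Real.pi * k / β)
  have hlim : Tendsto (fun n : ℕ => (1 / (β : ℝ)) * (Real.log n / n - Real.log β / n
      + ∑ k ∈ Finset.Ico 1 β, Real.log (Q k n) / n)) atTop
      (𝓝 ((1 / (β : ℝ)) * (0 - 0 + ∑ k ∈ Finset.Ico 1 β, Real.arcosh (coshRate β γ k)))) := by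
    refine Tendsto.const_mul _ (Tendsto.add (Tendsto.sub ?_ ?_) ?_)
    · have h := Real.tendsto_pow_log_div_mul_add_atTop 1 0 1 one_ne_zero
      simpa [Function.comp_def] using h.comp tendsto_natCast_atTop_atTop
    · exact tendsto_const_div_atTop_nhds_zero_nat _
    · refine tendsto_finsetSum _ fun k hk => ?_
      rw [Finset.mem_Ico] at hk
      exact tendsto_log_two_cosh_div (Real.arcosh_nonneg (one_le_coshRate β γ k))
        (Real.neg_one_le_cos _) (cos_two_pi_mul_div_lt_one hk.1 hk.2)
  rw [sub_zero, zero_add] at hlim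
  refine hlim.congr' ?_
  filter_upwards [eventually_gt_atTop 0] with n hn
  have hn0 : (0 : ℝ) < n := by exact_mod_cast hn
  have hQ : ∀ k ∈ Finset.Ico 1 β, Q k n ≠ 0 := by
    intro k hk
    rw [Finset.mem_Ico] at hk
    have := cos_two_pi_mul_div_lt_one hk.1 hk.2
    have h1 := Real.one_le_cosh (n * Real.arcosh (coshRate β γ k))
    simp only [Q]
    exact (by linarith : (0 : ℝ) < _).ne'
  have hτ := numSpanningTrees_nonFixed hβ hn γ
  have hτ0 : (numSpanningTrees (nonFixedCirculant β γ n) : ℝ) ≠ 0 := by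
    intro h0
    rw [h0, mul_zero] at hτ
    exact mul_ne_zero (pow_ne_zero 2 hn0.ne') (Finset.prod_ne_zero_iff.2 hQ) hτ.symm
  have hlog := congrArg Real.log hτ
  rw [Real.log_mul (by positivity) hτ0, Real.log_mul hβ0.ne' hn0.ne',
    Real.log_mul (by positivity) (Finset.prod_ne_zero_iff.2 hQ), Real.log_pow,
    Real.log_prod hQ] at hlog
  rw [← Finset.sum_div]
  have hsum : ∑ k ∈ Finset.Ico 1 β, Real.log (Q k n)
      = Real.log β + Real.log n + Real.log (numSpanningTrees (nonFixedCirculant β γ n))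
        - 2 * Real.log n := by
    push_cast at hlog
    linarith
  rw [hsum]
  field_simp
  ring

end Entropy

/-! ### The Bessel integral -/

section Bessel

open MeasureTheory Filter Topology Set

/-- The moments of the cosine over a period. -/
lemma integral_cos_pow_period (j : ℕ) :
    (∫ x in (0 : ℝ)..2 * Real.pi, Real.cos x ^ (2 * j))
        = 2 * Real.pi * ((2 * j).factorial / (4 ^ j * (j.factorial : ℝ) ^ 2)) ∧
      (∫ x in (0 : ℝ)..2 * Real.pi, Real.cos x ^ (2 * j + 1)) = 0 := by
  induction j with
  | zero => simp
  | succ j ih =>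
    constructor
    · rw [Nat.mul_succ, integral_cos_pow, ih.1, Real.sin_two_pi, Real.sin_zero,
        show (2 * j + 2).factorial = (2 * j + 2) * ((2 * j + 1) * (2 * j).factorial) from rfl,
        Nat.factorial_succ]
      have h1 : (j.factorial : ℝ) ≠ 0 := by exact_mod_cast j.factorial_ne_zero
      push_cast
      field_simp
      ring
    · rw [show 2 * (j + 1) + 1 = (2 * j + 1) + 2 by ring, integral_cos_pow, ih.2,
        Real.sin_two_pi, Real.sin_zero]
      simp

/-- The integral representation of `I_0`, obtained from the exponential series. -/
lemma integral_exp_mul_cos (t : ℝ) :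
    ∫ x in (0 : ℝ)..2 * Real.pi, Real.exp (2 * t * Real.cos x)
      = 2 * Real.pi * besselI0 (2 * t) := by
  have hexp : ∀ y : ℝ, HasSum (fun n : ℕ => y ^ n / n.factorial) (Real.exp y) := by
    intro y
    rw [Real.exp_eq_exp_ℝ]
    exact NormedSpace.exp_series_hasSum_exp' y |>.congr_fun fun n => by
      rw [div_eq_inv_mul, smul_eq_mul]
  have hsum : HasSum (fun n : ℕ => ∫ x in (0 : ℝ)..2 * Real.pi,
      (2 * t * Real.cos x) ^ n / n.factorial)
      (∫ x in (0 : ℝ)..2 * Real.pi, Real.exp (2 * t * Real.cos x)) := by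
    refine intervalIntegral.hasSum_integral_of_dominated_convergence
      (fun n _ => |2 * t| ^ n / n.factorial) (fun n => ?_) (fun n => ?_) ?_ ?_ ?_
    · exact (by fun_prop : Continuous fun x : ℝ =>
        (2 * t * Real.cos x) ^ n / (n.factorial : ℝ)).aestronglyMeasurable
    · refine Eventually.of_forall fun x _ => ?_
      rw [norm_div, norm_pow, Real.norm_natCast, Real.norm_eq_abs, abs_mul]
      have : |2 * t| * |Real.cos x| ≤ |2 * t| :=
        mul_le_of_le_one_right (abs_nonneg _) (Real.abs_cos_le_one x)
      gcongr
    · exact Eventually.of_forall fun x _ => (hexp _).summable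
    · exact intervalIntegrable_const
    · exact Eventually.of_forall fun x _ => hexp _
  have hinj : Function.Injective fun j : ℕ => 2 * j := fun a b h => by simpa using h
  have hmul : ∀ n : ℕ, ∫ x in (0 : ℝ)..2 * Real.pi, (2 * t * Real.cos x) ^ n / n.factorial
      = (2 * t) ^ n / n.factorial * ∫ x in (0 : ℝ)..2 * Real.pi, Real.cos x ^ n := by
    intro n
    rw [← intervalIntegral.integral_const_mul]
    congr 1
    funext x
    rw [mul_pow]
    ring
  rw [← hinj.hasSum_iff] at hsum
  · rw [← hsum.tsum_eq, besselI0, ← tsum_mul_left]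
    refine tsum_congr fun j => ?_
    have h1 : (j.factorial : ℝ) ≠ 0 := by exact_mod_cast j.factorial_ne_zero
    have h2 : ((2 * j).factorial : ℝ) ≠ 0 := by exact_mod_cast (2 * j).factorial_ne_zero
    rw [Function.comp_apply, hmul, (integral_cos_pow_period j).1, mul_div_cancel_left₀ _ two_ne_zero,
      mul_pow, pow_mul 2 2 j]
    norm_num
    field_simp
  · intro n hn
    have hodd : ∃ j, n = 2 * j + 1 := by
      rcases Nat.even_or_odd' n with ⟨j, rfl | rfl⟩
      · exact absurd ⟨j, rfl⟩ hn
      · exact ⟨j, rfl⟩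
    obtain ⟨j, rfl⟩ := hodd
    rw [hmul, (integral_cos_pow_period j).2, mul_zero]

/-- The Frullani integrand is bounded by an exponential. -/
lemma abs_exp_sub_exp_div_le {s t : ℝ} (ht : 0 < t) :
    |(Real.exp (-t) - Real.exp (-s * t)) / t| ≤ |s - 1| * Real.exp (-(min 1 s) * t) := by
  rw [abs_div, abs_of_pos ht, div_le_iff₀ ht]
  rcases le_total 1 s with hs | hs
  · have h1 : Real.exp (-s * t) = Real.exp (-t) * Real.exp (-((s - 1) * t)) := by
      rw [← Real.exp_add]; ring_nf
    have h2 := Real.add_one_le_exp (-((s - 1) * t))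
    have h3 : Real.exp (-s * t) ≤ Real.exp (-t) := Real.exp_le_exp.2 (by nlinarith)
    rw [abs_of_nonneg (by linarith), abs_of_nonneg (by linarith), min_eq_left hs,
      show -1 * t = -t by ring]
    nlinarith [Real.exp_pos (-t)]
  · have h1 : Real.exp (-t) = Real.exp (-s * t) * Real.exp (-((1 - s) * t)) := by
      rw [← Real.exp_add]; ring_nf
    have h2 := Real.add_one_le_exp (-((1 - s) * t))
    have h3 : Real.exp (-t) ≤ Real.exp (-s * t) := Real.exp_le_exp.2 (by nlinarith)
    rw [abs_of_nonpos (by linarith), abs_of_nonpos (by linarith), min_eq_right hs]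
    nlinarith [Real.exp_pos (-s * t)]

lemma integrableOn_frullani_exp {s : ℝ} (hs : 0 < s) :
    IntegrableOn (fun t : ℝ => (Real.exp (-t) - Real.exp (-s * t)) / t) (Ioi 0) := by
  have hdom : IntegrableOn (fun t : ℝ => |s - 1| * Real.exp (-(min 1 s) * t)) (Ioi 0) :=
    (integrableOn_exp_mul_Ioi (by simpa using hs) 0).const_mul _
  refine hdom.mono' (Measurable.aestronglyMeasurable (by fun_prop)) ?_
  filter_upwards [ae_restrict_mem measurableSet_Ioi] with t ht
  exact abs_exp_sub_exp_div_le ht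

/-- Frullani's integral for the exponential. -/
lemma integral_frullani_exp {s : ℝ} (hs : 0 < s) :
    ∫ t in Ioi (0 : ℝ), (Real.exp (-t) - Real.exp (-s * t)) / t = Real.log s := by
  have hfun : ∀ t : ℝ, (Real.exp (-t) - Real.exp (-s * t)) / t
      = t⁻¹ • (Real.exp (-(1 * t)) - Real.exp (-(s * t))) := by
    intro t
    rw [smul_eq_mul, div_eq_inv_mul, one_mul, neg_mul]
  have hint := integrableOn_frullani_exp hs
  simp only [hfun] at hint ⊢
  have hcont : Continuous fun x : ℝ => Real.exp (-x) := by fun_prop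
  have h := Frullani.integral_Ioi_eq (f := fun x : ℝ => Real.exp (-x)) (L := 1) (R := 0)
    (hcont.locallyIntegrable.locallyIntegrableOn _) one_pos hs
    (by
      have := hcont.tendsto 0
      simp only [neg_zero, Real.exp_zero] at this
      exact this.mono_left nhdsWithin_le_nhds)
    (Real.tendsto_exp_neg_atTop_nhds_zero) hint
  rw [h]
  simp

lemma integral_norm_frullani_exp {s : ℝ} (hs : 0 < s) :
    ∫ t in Ioi (0 : ℝ), ‖(Real.exp (-t) - Real.exp (-s * t)) / t‖ = |Real.log s| := by
  rcases le_total 1 s with h1 | h1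
  · rw [abs_of_nonneg (Real.log_nonneg h1), ← integral_frullani_exp hs]
    refine setIntegral_congr_fun measurableSet_Ioi fun t ht => ?_
    have ht0 : (0 : ℝ) < t := ht
    have h3 : Real.exp (-s * t) ≤ Real.exp (-t) := Real.exp_le_exp.2 (by nlinarith)
    exact abs_of_nonneg (div_nonneg (by linarith) ht0.le)
  · rw [abs_of_nonpos (Real.log_nonpos hs.le h1), ← integral_frullani_exp hs, ← integral_neg]
    refine setIntegral_congr_fun measurableSet_Ioi fun t ht => ?_
    have ht0 : (0 : ℝ) < t := ht
    have h3 : Real.exp (-t) ≤ Real.exp (-s * t) := Real.exp_le_exp.2 (by nlinarith)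
    exact abs_of_nonpos (div_nonpos_of_nonpos_of_nonneg (by linarith) ht0.le)

lemma two_cosh_sub_two_cos_eq (θ x : ℝ) :
    2 * Real.cosh θ - 2 * Real.cos x
      = Real.exp (-θ) * ‖circleMap 0 1 x - (Real.exp θ : ℂ)‖ ^ 2 := by
  have h1 : ‖circleMap 0 1 x - (Real.exp θ : ℂ)‖ ^ 2
      = (Real.cos x - Real.exp θ) ^ 2 + Real.sin x ^ 2 := by
    rw [← Complex.normSq_eq_norm_sq, Complex.normSq_apply]
    simp [circleMap, Complex.exp_ofReal_mul_I_re, Complex.exp_ofReal_mul_I_im,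
      Complex.exp_ofReal_re]
    ring
  have h2 : Real.exp (-θ) * Real.exp θ = 1 := by
    rw [← Real.exp_add]; simp
  rw [h1, Real.cosh_eq]
  linear_combination (2 * Real.cos x - Real.exp θ) * h2
    - Real.exp (-θ) * Real.sin_sq_add_cos_sq x

lemma two_cosh_sub_two_cos_pos (θ : ℝ) {x : ℝ} (hx : x ∈ Ioo 0 (2 * Real.pi)) :
    0 < 2 * Real.cosh θ - 2 * Real.cos x := by
  have h1 := Real.one_le_cosh θ
  have h2 : Real.cos x < 1 := by
    refine lt_of_le_of_ne (Real.cos_le_one x) fun h => ?_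
    have := (Real.cos_eq_one_iff_of_lt_of_lt (by linarith [hx.1, Real.pi_pos]) hx.2).1 h
    exact hx.1.ne' this
  linarith

lemma log_two_cosh_sub_two_cos (θ : ℝ) {x : ℝ} (hx : x ∈ Ioo 0 (2 * Real.pi)) :
    Real.log (2 * Real.cosh θ - 2 * Real.cos x)
      = -θ + 2 * Real.log ‖circleMap 0 1 x - (Real.exp θ : ℂ)‖ := by
  have hpos := two_cosh_sub_two_cos_pos θ hx
  rw [two_cosh_sub_two_cos_eq] at hpos ⊢
  have hne : ‖circleMap 0 1 x - (Real.exp θ : ℂ)‖ ^ 2 ≠ 0 := (pos_of_mul_pos_right hpos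
    (Real.exp_pos _).le).ne'
  rw [Real.log_mul (Real.exp_pos _).ne' hne, Real.log_exp, Real.log_pow]
  push_cast
  rfl

lemma integrableOn_log_norm_circleMap_sub (a : ℂ) :
    IntegrableOn (fun x => Real.log ‖circleMap 0 1 x - a‖) (Ioo 0 (2 * Real.pi)) := by
  have h := circleIntegrable_log_norm_sub_const (a := a) (c := 0) 1
  unfold CircleIntegrable at h
  rw [intervalIntegrable_iff_integrableOn_Ioo_of_le Real.two_pi_pos.le] at h
  exact h

lemma integrableOn_log_two_cosh_sub_two_cos (θ : ℝ) :
    IntegrableOn (fun x => Real.log (2 * Real.cosh θ - 2 * Real.cos x))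
      (Ioo 0 (2 * Real.pi)) := by
  refine IntegrableOn.congr_fun ?_ (fun x hx => (log_two_cosh_sub_two_cos θ hx).symm)
    measurableSet_Ioo
  exact (integrableOn_const measure_Ioo_lt_top.ne).add
    ((integrableOn_log_norm_circleMap_sub _).const_mul 2)

/-- Jensen's formula for `z - e^θ` on the unit circle, in real form. -/
lemma integral_log_two_cosh_sub_two_cos {θ : ℝ} (hθ : 0 ≤ θ) :
    ∫ x in Ioo 0 (2 * Real.pi), Real.log (2 * Real.cosh θ - 2 * Real.cos x)
      = 2 * Real.pi * θ := by
  have hpi := Real.pi_pos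
  have hJ := circleAverage_log_norm_sub_const_eq_posLog (a := (Real.exp θ : ℂ))
  rw [Real.circleAverage_def, intervalIntegral.integral_of_le Real.two_pi_pos.le,
    integral_Ioc_eq_integral_Ioo, Complex.norm_real, Real.norm_eq_abs, Real.posLog_abs,
    Real.posLog, Real.log_exp, max_eq_right hθ, smul_eq_mul,
    inv_mul_eq_iff_eq_mul₀ Real.two_pi_pos.ne'] at hJ
  rw [setIntegral_congr_fun measurableSet_Ioo fun x hx => log_two_cosh_sub_two_cos θ hx,
    integral_add (integrableOn_const (C := -θ) measure_Ioo_lt_top.ne).integrable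
      ((integrableOn_log_norm_circleMap_sub _).const_mul 2), integral_const_mul, hJ,
    setIntegral_const]
  simp only [Measure.real, Real.volume_Ioo, smul_eq_mul]
  rw [ENNReal.toReal_ofReal (by linarith)]
  ring

/-- The function to which Fubini's theorem is applied is absolutely integrable, since its inner
integrals are those of Frullani. -/
lemma integrable_prod_frullani (θ : ℝ) :
    Integrable (fun p : ℝ × ℝ =>
      (Real.exp (-p.1) - Real.exp (-(2 * Real.cosh θ - 2 * Real.cos p.2) * p.1)) / p.1)
      ((volume.restrict (Ioi 0)).prod (volume.restrict (Ioo 0 (2 * Real.pi)))) := by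
  rw [integrable_prod_iff' (by
    refine Measurable.aestronglyMeasurable ?_
    fun_prop)]
  constructor
  · filter_upwards [ae_restrict_mem measurableSet_Ioo] with x hx
    exact integrableOn_frullani_exp (two_cosh_sub_two_cos_pos θ hx)
  · refine IntegrableOn.congr_fun (integrableOn_log_two_cosh_sub_two_cos θ).abs ?_
      measurableSet_Ioo
    intro x hx
    exact (integral_norm_frullani_exp (two_cosh_sub_two_cos_pos θ hx)).symm

lemma integral_frullani_angle (a t : ℝ) :
    ∫ x in Ioo 0 (2 * Real.pi), (Real.exp (-t) - Real.exp (-(2 * a - 2 * Real.cos x) * t)) / t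
      = 2 * Real.pi * ((Real.exp (-t) - Real.exp (-(2 * a) * t) * besselI0 (2 * t)) / t) := by
  have hsplit : ∀ x : ℝ, Real.exp (-(2 * a - 2 * Real.cos x) * t)
      = Real.exp (-(2 * a) * t) * Real.exp (2 * t * Real.cos x) := by
    intro x
    rw [← Real.exp_add]
    ring_nf
  rw [← integral_Ioc_eq_integral_Ioo, ← intervalIntegral.integral_of_le Real.two_pi_pos.le,
    intervalIntegral.integral_div, intervalIntegral.integral_sub]
  · simp only [hsplit]
    rw [intervalIntegral.integral_const_mul, integral_exp_mul_cos]
    simp only [intervalIntegral.integral_const, smul_eq_mul]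
    ring
  · exact intervalIntegrable_const
  · exact (by fun_prop : Continuous fun x : ℝ =>
      Real.exp (-(2 * a - 2 * Real.cos x) * t)).intervalIntegrable _ _

/-- `∫ (e^{-t} - e^{-2at} I_0(2t)) dt / t = arcosh a`: with the integral representation of `I_0`,
the order of integration is exchanged, and Frullani's integral is followed by Jensen's formula. -/
theorem integral_bessel {a : ℝ} (ha : 1 ≤ a) :
    IntegrableOn (fun t : ℝ =>
      (Real.exp (-t) - Real.exp (-(2 * a) * t) * besselI0 (2 * t)) / t) (Ioi 0) ∧
    ∫ t in Ioi (0 : ℝ), (Real.exp (-t) - Real.exp (-(2 * a) * t) * besselI0 (2 * t)) / t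
      = Real.arcosh a := by
  have hpi := Real.two_pi_pos
  have hint := integrable_prod_frullani (Real.arcosh a)
  have hfub := integral_integral_swap (f := fun t x : ℝ =>
    (Real.exp (-t) - Real.exp (-(2 * Real.cosh (Real.arcosh a) - 2 * Real.cos x) * t)) / t) hint
  have hleft := hint.integral_prod_left
  rw [setIntegral_congr_fun measurableSet_Ioo fun x hx =>
    integral_frullani_exp (two_cosh_sub_two_cos_pos (Real.arcosh a) hx),
    integral_log_two_cosh_sub_two_cos (Real.arcosh_nonneg ha)] at hfub
  simp only [Real.cosh_arcosh ha, integral_frullani_angle] at hfub hleft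
  constructor
  · refine (hleft.const_mul (2 * Real.pi)⁻¹).congr (Eventually.of_forall fun t => ?_)
    exact inv_mul_cancel_left₀ hpi.ne' _
  · rw [integral_const_mul] at hfub
    exact mul_left_cancel₀ hpi.ne' hfub

end Bessel

/-! ### Entropy, integral and spectrum -/

lemma coshRate_eq {d : ℕ} (hd : 1 ≤ d) (β : ℕ) (γ : Fin (d - 1) → ℕ) (k : ℕ) :
    coshRate β γ k = (d : ℝ) - ∑ m, Real.cos (2 * Real.pi * k * γ m / β) := by
  simp only [coshRate, Finset.sum_sub_distrib, Finset.sum_const, Finset.card_univ,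
    Fintype.card_fin, nsmul_eq_mul, mul_one, Nat.cast_sub hd, Nat.cast_one]
  ring

lemma mu_eq_coshRate {d : ℕ} (hd : 1 ≤ d) (β : ℕ) (γ : Fin (d - 1) → ℕ) (k : ℕ) :
    mu d β γ k = 2 * coshRate β γ k - 2 := by
  rw [coshRate_eq hd, mu]
  ring

lemma mu_eq_eigval {d : ℕ} (hd : 1 ≤ d) (β : ℕ) (γ : Fin (d - 1) → ℕ) (k : ℕ) :
    mu d β γ k = eigval β γ k := by
  rw [mu_eq_coshRate hd, coshRate, eigval, mul_add, Finset.mul_sum]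
  simp only [mul_sub, mul_one]
  ring

/-- The integrand is the average over `k` of the integrands of `integral_bessel`. -/
lemma entropy_integrand_eq {d β : ℕ} (hd : 1 ≤ d) (hβ : 0 < β) (γ : Fin (d - 1) → ℕ) (t : ℝ) :
    (Real.exp (-t) - (1 / (β : ℝ)) * ∑ k ∈ Finset.range β,
        Real.exp (-(mu d β γ k) * t) * Real.exp (-2 * t) * besselI0 (2 * t)) / t
      = (1 / (β : ℝ)) * ∑ k ∈ Finset.range β,
        (Real.exp (-t) - Real.exp (-(2 * coshRate β γ k) * t) * besselI0 (2 * t)) / t := by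
  have hβ0 : (β : ℝ) ≠ 0 := by exact_mod_cast hβ.ne'
  have hk : ∀ k, Real.exp (-(mu d β γ k) * t) * Real.exp (-2 * t)
      = Real.exp (-(2 * coshRate β γ k) * t) := by
    intro k
    rw [← Real.exp_add, mu_eq_coshRate hd]
    ring_nf
  simp only [hk]
  rw [← Finset.sum_div, Finset.sum_sub_distrib, Finset.sum_const, Finset.card_range, nsmul_eq_mul,
    ← mul_div_assoc, mul_sub, ← mul_assoc, one_div, inv_mul_cancel₀ hβ0, one_mul]

lemma sum_range_arcosh_coshRate {β r : ℕ} (hβ : 0 < β) (γ : Fin r → ℕ) :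
    ∑ k ∈ Finset.range β, Real.arcosh (coshRate β γ k)
      = ∑ k ∈ Finset.Ico 1 β, Real.arcosh (coshRate β γ k) := by
  have h0 : coshRate β γ 0 = 1 := by simp [coshRate]
  rw [Finset.range_eq_Ico, Finset.sum_eq_sum_Ico_succ_bot hβ, h0, Real.arcosh_zero, zero_add]

end CirculantEntropy

open CirculantEntropy in
theorem mainTheorem3 (d β : ℕ) [NeZero β] (hd : 1 ≤ d) (γ : Fin (d - 1) → ℕ)
    (hγ_pos : ∀ m, 1 ≤ γ m) (hγ_mono : Monotone γ) (hγ_le : ∀ m, γ m ≤ β / 2) :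
    HasTreeEntropy (fun n => nonFixedCirculant β γ n)
      ((1 / (β : ℝ)) * ∑ k ∈ Finset.Icc 1 (β - 1),
        Real.arcosh ((d : ℝ) - ∑ m, Real.cos (2 * Real.pi * k * γ m / β))) ∧
    MeasureTheory.IntegrableOn (fun t : ℝ =>
      (Real.exp (-t) - (1 / (β : ℝ)) * ∑ k ∈ Finset.range β,
        Real.exp (-(mu d β γ k) * t) * Real.exp (-2 * t) * besselI0 (2 * t)) / t)
      (Set.Ioi 0) ∧
    (1 / (β : ℝ)) * ∑ k ∈ Finset.Icc 1 (β - 1),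
        Real.arcosh ((d : ℝ) - ∑ m, Real.cos (2 * Real.pi * k * γ m / β)) =
      ∫ t in Set.Ioi (0 : ℝ),
        (Real.exp (-t) - (1 / (β : ℝ)) * ∑ k ∈ Finset.range β,
          Real.exp (-(mu d β γ k) * t) * Real.exp (-2 * t) * besselI0 (2 * t)) / t ∧
    (laplacian (circulant β γ)).charpoly =
      ∏ k ∈ Finset.range β, (Polynomial.X - Polynomial.C (mu d β γ k)) := by
  have hβ : 0 < β := Nat.pos_of_ne_zero (NeZero.ne β)
  have hIcc : Finset.Icc 1 (β - 1) = Finset.Ico 1 β := by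
    ext k
    simp only [Finset.mem_Icc, Finset.mem_Ico]
    omega
  have hint : ∀ k, MeasureTheory.IntegrableOn (fun t : ℝ =>
      (Real.exp (-t) - Real.exp (-(2 * coshRate β γ k) * t) * besselI0 (2 * t)) / t)
      (Set.Ioi 0) := fun k => (integral_bessel (one_le_coshRate β γ k)).1
  simp only [hIcc, ← coshRate_eq hd, entropy_integrand_eq hd hβ]
  refine ⟨hasTreeEntropy_nonFixed hβ γ, ?_, ?_, ?_⟩
  · exact (MeasureTheory.integrable_finsetSum _ fun k _ => hint k).const_mul _
  · rw [MeasureTheory.integral_const_mul, MeasureTheory.integral_finsetSum _ fun k _ => hint k,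
      Finset.sum_congr rfl fun k _ => (integral_bessel (one_le_coshRate β γ k)).2,
      sum_range_arcosh_coshRate hβ]
  · rw [charpoly_laplacian_circulant]
    simp only [mu_eq_eigval hd]
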